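/- **The space.** All spaces are real. Let $(m_j,n_j)_{j\ge 1}$ be natural numbers with $m_1\ge 4$, $m_{j+1}\ge m_j^2$, $n_1\ge m_1^2$, $n_{j+1}\ge (16n_j)^{\log_2 m_{j+1}}$; let $L\subset\mathbb N=\{1,2,\dots\}$ be infinite, let $l_1<l_2<\cdots$ be its elements, and put $m'_j=m_{l_j}$, $n'_j=n_{l_j}$ (so $m'_1=m_{\min L}$). Let $(X_k)_{k\ge1}$ be separable Banach spaces. The Argyros–Haydon sum $\mathcal Z=(\sum\oplus X_k)_{AH(L)}$ is built as follows. Recursively one defines pairwise disjoint finite sets $\Delta_1,\Delta_2,\dots$; put $\Gamma_n=\Delta_1\cup\dots\cup\Delta_n$, $\Gamma=\bigcup_n\Gamma_n$, and say that $\gamma\in\Delta_n$ has rank $n$. The set $\Delta_1$ is an arbitrary finite set. For $n\ge1$, $\Delta_{n+1}=\Delta_{n+1}^0\cup\Delta_{n+1}^1$, where: * $\Delta^0_{n+1}$ consists of the elements $(n+1,f)$, where $f=(f_k)_{k\le n}$ runs over a chosen finite family of elements of the unit ball of $(\sum_{k\le n}\oplus X_k^*)_1$; all these families together norm each $X_k$,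 i.e. $\|x\|$ is the supremum of $|f_k(x)|$ over the chosen $f$, for all $k$ and $x\in X_k$. * $\Delta_{n+1}^1$ consists of the elements of weight $m'_j$ with $1\le j\le n+1$, of two kinds: $(n+1,m'_j,p,b^*)$, of age $1$, with an admissible $0\le p<n$; and $(n+1,\xi,m'_j,p,b^*)$, where $\xi\in\Gamma_n$ has weight $m'_j$ and age $<n'_j$, with an admissible $p<n$, $p\ge \operatorname{rank}\xi$; its age is that of $\xi$ plus one. If $j$ is even, $b^*$ runs over $B_{p,n}$, a chosen finite $2^{-n}$-net, with rational coefficients, of the unit ball of $\ell_1(\Gamma_n\setminus\Gamma_p)$. If $j$ is odd, $b^*=e^*_\eta$ with $\eta\in\Gamma_n\setminus\Gamma_p$, where $\eta$ has weight $m'_{4i-2}>(n'_j)^2$ for some $i\ge 1$ in the first kind, and weight $m'_{4\sigma(\xi)}$ in the second kind. Here $\sigma:\Gamma\to\mathbb N$ is a chosen one-to-one coding function with $\sigma(\gamma)\ge\operatorname{rank}\gamma$. Which $p$ are admissible is a fixed choice, depending only on $r=\operatorname{rank}\xi$ ($r=0$ for the first kind), such that every admissible $p$ is $\ge r$ and $p=r$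 is admissible whenever $r<n$ (Argyros and Haydon admit only $p=r$). Let $\mathcal Z_\infty=\big(\sum_k\oplus(X_k\oplus\ell_\infty(\Delta_k))_\infty\big)_\infty$, and let $R_{[1,n]}$ be the restriction to the first $n$ coordinates. The linear extension operators $i_n:\big(\sum_{k\le n}\oplus(X_k\oplus\ell_\infty(\Delta_k))_\infty\big)_\infty\to\mathcal Z_\infty$ are determined by: $R_{[1,n]}i_n(u)=u$; all $X_k$-coordinates of $z=i_n(u)$ with $k>n$ vanish; and for $q\ge n$ and $\gamma\in\Delta_{q+1}$ the $\gamma$-coordinate of $z$ is $c^*_\gamma(z)$, where, with $P_{(p,q]}=i_qR_{[1,q]}-i_pR_{[1,p]}$, $$c_\gamma^*=0\ (\gamma\in\Delta_1),\qquad c^*_{(q+1,f)}(z)=\tfrac1{m_{\min L}}\sum_{k\le q}f_k(z_k),$$ $$c^*_{(q+1,m'_j,p,b^*)}=\tfrac1{m'_j}\,b^*\circ P_{(p,q]},\qquad c^*_{(q+1,\xi,m'_j,p,b^*)}=e^*_\xi+\tfrac1{m'_j}\,b^*\circ P_{(p,q]},$$ where $z_k$ is the $X_k$-coordinate of $z$.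 Finally $\mathcal Z$ is the closed linear span in $\mathcal Z_\infty$ of the ranges of the operators $i_n$, $n\ge1$. **Proposition.** Let $\mathcal Z=(\sum\oplus X_k)_{AH(L)}$ be as above, for any choices as described. Let $n\in\mathbb N$, let $T_k:X_k\to X_k$ ($1\le k\le n$) be bounded linear operators and $\lambda\in\mathbb R$. Let $j_k$ be the embedding of $X_k$ as the $X_k$-coordinate into $\big(\sum_{l\le k}\oplus(X_l\oplus\ell_\infty(\Delta_l))_\infty\big)_\infty$, let $\pi_k$ be the corresponding coordinate map, and let $P_{(n,\infty)}=I-i_nR_{[1,n]}$. Then $$T=\sum_{k=1}^n i_k\,j_k\,T_k\,\pi_k\,R_{[1,k]}+\lambda P_{(n,\infty)}$$ is a bounded linear operator $T:\mathcal Z\to\mathcal Z$, and there is a bounded finite-rank (hence compact) operator $K:\mathcal Z\to\mathcal Z$ with $$\|T-K\|\le\Big(1+\frac{4}{m_{\min L}-2}\Big)\max\Big\{\max_{1\le k\le n}\|T_k\|,\ |\lambda|\Big\}.$$ -/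

import Mathlib

open scoped ENNReal NNReal

/-- The lacunarity conditions on the parameters `(m_j, n_j)`, `j = 1, 2, …`, of the
Argyros–Haydon construction (the values at `j = 0` are irrelevant). -/
structure AHLacunary (m n : ℕ → ℕ) : Prop where
  four_le : 4 ≤ m 1
  sq_le : ∀ j, 1 ≤ j → m j ^ 2 ≤ m (j + 1)
  sq_le_n : m 1 ^ 2 ≤ n 1
  pow_le : ∀ j, 1 ≤ j → (16 * (n j : ℝ)) ^ Real.logb 2 (m (j + 1)) ≤ (n (j + 1) : ℝ)

/-- The tuples that serve as elements of `Γ = ⋃ Δ_n`. Elements of `Γ` are themselves labelled by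
natural numbers (the sets `Δ_n` are subsets of `ℕ`), so a tuple refers to earlier elements of `Γ`
through their labels; a finitely supported `b : ℕ →₀ ℚ` stands for the functional
`b* = ∑ b η • e*_η`.
* `base i`: the `i`-th element of `Δ_1`;
* `func n i`: the element `(n+1, f)` of `Δ⁰_{n+1}`, where `f` is the `i`-th chosen functional in
  the unit ball of `(∑_{k ≤ n} X_k*)_1`;
* `weighted n j a pred p b`: an element of `Δ¹_{n+1}` of weight `m_j` and age `a`, with
  predecessor `ξ` if `pred = some ξ` (none if `a = 1`), and with the functional `b*`
  acting after `P_{(p, n]}`. -/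
inductive AHNode : Type
  | base (i : ℕ)
  | func (n i : ℕ)
  | weighted (n j a : ℕ) (pred : Option ℕ) (p : ℕ) (b : ℕ →₀ ℚ)

namespace AHNode

/-- The `n` with `γ ∈ Δ_n`. -/
def rank : AHNode → ℕ
  | base _ => 1
  | func n _ => n + 1
  | weighted n _ _ _ _ _ => n + 1

/-- The index `j` of the weight `m_j`, for elements that have a weight. -/
def weight : AHNode → Option ℕ
  | weighted _ j _ _ _ _ => some j
  | _ => none

/-- The age of a weighted element. -/
def age : AHNode → ℕ
  | weighted _ _ a _ _ _ => a
  | _ => 0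

end AHNode

/-- The free choices in the construction of an Argyros–Haydon sum of `X 0, X 1, …`
(`X k` is the `(k+1)`-st space, so that the first `n` spaces are the `X k` with `k < n`).
* `label`: the identification of tuples with natural numbers;
* `card₁`: the number of elements of `Δ_1`;
* `card₀ n` and `fn n i`, `i < card₀ n`: the finitely many functionals `f = (f_k)_{k < n}`
  that are used for `Δ⁰_{n+1}`;
* `net p n`: the finite net `B_{p,n}` of the unit ball of `ℓ₁(Γ_n \ Γ_p)`;
* `code`: the coding function `σ`;
* `cut r p`: the interval `(p, n]` may be used for an element whose predecessor has rank `r`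
  (`r = 0`: no predecessor). The choice `cut r p ↔ p = r` is that of Argyros and Haydon,
  the choice `cut r p ↔ r ≤ p` is the most generous one. -/
structure AHChoices (X : ℕ → Type*) [∀ k, NormedAddCommGroup (X k)]
    [∀ k, NormedSpace ℝ (X k)] where
  label : ℕ ≃ AHNode
  card₁ : ℕ
  card₀ : ℕ → ℕ
  fn : ℕ → ℕ → ∀ k, X k →L[ℝ] ℝ
  net : ℕ → ℕ → Finset (ℕ →₀ ℚ)
  code : ℕ → ℕ
  cut : ℕ → ℕ → Prop

/-- The `j`-th term (`j = 1, 2, …`) of the subsequence `(s_i)_{i ∈ L}`. -/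
noncomputable def subseq (s : ℕ → ℕ) (L : Set ℕ) (j : ℕ) : ℕ :=
  s (Nat.nth (fun i => i ∈ L) (j - 1))

namespace AHChoices

variable {X : ℕ → Type*} [∀ k, NormedAddCommGroup (X k)] [∀ k, NormedSpace ℝ (X k)]

/-- The rank of the element with label `γ`. -/
def rank (D : AHChoices X) (γ : ℕ) : ℕ := (D.label γ).rank

/-- The weight index of the element with label `γ`. -/
def weight (D : AHChoices X) (γ : ℕ) : Option ℕ := (D.label γ).weight

/-- The age of the element with label `γ`. -/
def age (D : AHChoices X) (γ : ℕ) : ℕ := (D.label γ).age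

/-- The tuples that belong to `Δ_{n+1}`, when `G = Γ_n` is already known and the parameters are
`(m_j, n_j)_{j ∈ L}`. Even weights admit every `b* ∈ B_{p,n}`; odd weights admit only `e*_η`
with `η ∈ Γ_n \ Γ_p` of weight `m_{4i-2} > n_j²` (no predecessor) or of weight
`m_{4σ(ξ)}` (predecessor `ξ`). -/
def Allowed (D : AHChoices X) (m ν : ℕ → ℕ) (L : Set ℕ) (n : ℕ) (G : Set ℕ) : AHNode → Prop
  | .base i => n = 0 ∧ i < D.card₁
  | .func s i => s = n ∧ 1 ≤ n ∧ i < D.card₀ n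
  | .weighted s j a none p b =>
      s = n ∧ 1 ≤ j ∧ j ≤ n + 1 ∧ p < n ∧ a = 1 ∧ D.cut 0 p ∧
      ((Even j ∧ b ∈ D.net p n) ∨
       (Odd j ∧ ∃ η ∈ G, p < D.rank η ∧ b = Finsupp.single η 1 ∧
          ∃ i, 1 ≤ i ∧ D.weight η = some (4 * i - 2) ∧
            subseq ν L j ^ 2 < subseq m L (4 * i - 2)))
  | .weighted s j a (some ξ) p b =>
      s = n ∧ 1 ≤ j ∧ j ≤ n + 1 ∧ p < n ∧ ξ ∈ G ∧ D.weight ξ = some j ∧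
      D.age ξ < subseq ν L j ∧ a = D.age ξ + 1 ∧ D.cut (D.rank ξ) p ∧
      ((Even j ∧ b ∈ D.net p n) ∨
       (Odd j ∧ ∃ η ∈ G, p < D.rank η ∧ b = Finsupp.single η 1 ∧
          D.weight η = some (4 * D.code ξ)))

/-- `Γ_n = Δ_1 ∪ ⋯ ∪ Δ_n`. -/
def Gam (D : AHChoices X) (m ν : ℕ → ℕ) (L : Set ℕ) : ℕ → Set ℕ
  | 0 => ∅
  | n + 1 => Gam D m ν L n ∪ {γ | D.Allowed m ν L n (Gam D m ν L n) (D.label γ)}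

/-- `Γ = ⋃ Γ_n`. -/
def Gamma (D : AHChoices X) (m ν : ℕ → ℕ) (L : Set ℕ) : Set ℕ :=
  ⋃ n, D.Gam m ν L n

/-- The requirements on the choices: the functionals used for `Δ⁰_{n+1}` lie in the unit ball of
`(∑_{k ≤ n} X_k*)_1` and, all together, they norm every `X_k`; `B_{p,n}` is a finite `2⁻ⁿ`-net
of the unit ball of `ℓ₁(Γ_n \ Γ_p)`; the coding function is one-to-one on `Γ` and dominates
the rank; intervals start after the predecessor. -/
structure Admissible (D : AHChoices X) (m ν : ℕ → ℕ) (L : Set ℕ) : Prop where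
  fn_ball : ∀ n i, i < D.card₀ n → ∑ k ∈ Finset.range n, ‖D.fn n i k‖ ≤ 1
  fn_norming : ∀ k (x : X k), ∀ ε > 0, ∃ n, k < n ∧ ∃ i < D.card₀ n, ‖x‖ - ε < |D.fn n i k x|
  net_support : ∀ p n, p < n → ∀ b ∈ D.net p n, ∀ η ∈ b.support,
    η ∈ D.Gam m ν L n \ D.Gam m ν L p
  net_ball : ∀ p n, p < n → ∀ b ∈ D.net p n, ∑ η ∈ b.support, |b η| ≤ 1
  net_dense : ∀ p n, p < n → ∀ a : ℕ →₀ ℝ,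
    (∀ η ∈ a.support, η ∈ D.Gam m ν L n \ D.Gam m ν L p) → ∑ η ∈ a.support, |a η| ≤ 1 →
    ∃ b ∈ D.net p n, ∑ η ∈ a.support ∪ b.support, |a η - (b η : ℝ)| ≤ (1 / 2) ^ n
  code_injOn : Set.InjOn D.code (D.Gamma m ν L)
  rank_le_code : ∀ γ ∈ D.Gamma m ν L, D.rank γ ≤ D.code γ
  cut_self : ∀ r, D.cut r r
  le_of_cut : ∀ r p, D.cut r p → r ≤ p

/-- Formal vectors: one coordinate in each `X k` and one real coordinate for each label. -/
abbrev Vec (_D : AHChoices X) : Type _ := (∀ k, X k) × (ℕ → ℝ)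

/-- The functional `c*_γ` for `γ ∈ Δ_{s+1}`, evaluated at `z`, where `E p z` are the real
coordinates of `i_p (R_{[1,p]} z)`. It is `0` on `Δ_1`, it is `(1 / m_{min L}) f` on `Δ⁰_{s+1}`
and `e*_ξ + (1 / m_j) b* ∘ P_{(p,s]}` on `Δ¹_{s+1}`, without `e*_ξ` if there is no predecessor.
Since `b*` lives on `Γ_s`, one has `b* (P_{(p,s]} z) = b* (z - i_p (R_{[1,p]} z))`. -/
noncomputable def cStar (D : AHChoices X) (m : ℕ → ℕ) (L : Set ℕ)
    (E : ℕ → D.Vec → ℕ → ℝ) (γ : ℕ) (z : D.Vec) : ℝ :=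
  match D.label γ with
  | .base _ => 0
  | .func s i => (1 / (m (sInf L) : ℝ)) * ∑ k ∈ Finset.range s, D.fn s i k (z.1 k)
  | .weighted _ j _ pred p b =>
      pred.elim 0 z.2 +
        (1 / (subseq m L j : ℝ)) * ∑ η ∈ b.support, (b η : ℝ) * (z.2 η - E p z η)

open Classical in
/-- The first `n` coordinates in the spaces `X k`, followed by zeros. -/
noncomputable def trunc (n : ℕ) (x : ∀ k, X k) : ∀ k, X k := fun k => if k < n then x k else 0

open Classical in
/-- The real coordinates of `i_n (R_{[1,n]} z)` on `Γ_s ∪ Γ_n`, computed rank by rank: on `Γ_n`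
they are those of `z`, and for `γ ∈ Γ` of rank `s + 1 > n` the coordinate is the value of `c*_γ`
at the part constructed before. -/
noncomputable def extAux (D : AHChoices X) (m ν : ℕ → ℕ) (L : Set ℕ) :
    ℕ → ℕ → D.Vec → ℕ → ℝ
  | 0, n, z, γ => if γ ∈ D.Gam m ν L n then z.2 γ else 0
  | s + 1, n, z, γ =>
      if γ ∈ D.Gamma m ν L ∧ D.rank γ = s + 1 ∧ n < s + 1 then
        D.cStar m L (fun p w => extAux D m ν L s p w) γ
          (trunc n z.1, fun η => extAux D m ν L s n z η)
      else extAux D m ν L s n z γ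

/-- The vector `i_n (R_{[1,n]} z)`: the Bourgain–Delbaen extension of the first `n` coordinates
of `z`. -/
noncomputable def ext (D : AHChoices X) (m ν : ℕ → ℕ) (L : Set ℕ) (n : ℕ) (z : D.Vec) : D.Vec :=
  (trunc n z.1, fun γ => D.extAux m ν L (D.rank γ) n z γ)

/-- `Z_∞ = (∑ (X_k ⊕ ℓ_∞(Δ_k))_∞)_∞`, written as `(∑ X_k)_∞ ⊕_∞ ℓ_∞(Γ)`: both norms are the
supremum of the norms of all coordinates. -/
abbrev ZInfty (D : AHChoices X) (m ν : ℕ → ℕ) (L : Set ℕ) : Type _ :=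
  lp X ∞ × lp (fun _ : D.Gamma m ν L => ℝ) ∞

open Classical in
/-- The coordinates of an element of `Z_∞`. -/
noncomputable def coords (D : AHChoices X) (m ν : ℕ → ℕ) (L : Set ℕ) (z : D.ZInfty m ν L) :
    D.Vec :=
  (fun k => z.1 k, fun γ => if h : γ ∈ D.Gamma m ν L then z.2 ⟨γ, h⟩ else 0)

/-- `Y_n`, the range of `i_n` in `Z_∞`. -/
def Y (D : AHChoices X) (m ν : ℕ → ℕ) (L : Set ℕ) (n : ℕ) : Set (D.ZInfty m ν L) :=
  {z | ∃ u : D.Vec, D.coords m ν L z = D.ext m ν L n u}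

/-- The Argyros–Haydon sum `(∑ X_k)_{AH(L)}`: the closed linear span of `⋃ Y_n` in `Z_∞`. -/
noncomputable def space (D : AHChoices X) (m ν : ℕ → ℕ) (L : Set ℕ) :
    Submodule ℝ (D.ZInfty m ν L) :=
  (Submodule.span ℝ (⋃ n, D.Y m ν L n)).topologicalClosure

/-- The coordinates of `(T_1 ⊕ ⋯ ⊕ T_n) z + lam • P_{(n,∞)} z`, where `T_k` acts as
`i_k ∘ j_k ∘ T_k ∘ π_k ∘ R_{[1,k]}` and `P_{(n,∞)} = I - i_n ∘ R_{[1,n]}`. -/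
noncomputable def diag (D : AHChoices X) (m ν : ℕ → ℕ) (L : Set ℕ) (n : ℕ)
    (T : ∀ k : Fin n, X k →L[ℝ] X k) (lam : ℝ) (z : D.Vec) : D.Vec :=
  ∑ k : Fin n, D.ext m ν L (k + 1) (Pi.single (k : ℕ) (T k (z.1 k)), 0) +
    lam • (z - D.ext m ν L n z)

end AHChoices

/-! Let `M` be the maximum of `|lam|` and the norms of the `T k`, and put `μ = m (sInf L)`. The
operator `T` is compared with `U z = λ z + i_n(w)`, where `w` has `X_k`-coordinate `(T_k - λ) z_k`
for the first `n` spaces and is zero on `Γ_n`.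

`K = T - U` has finite rank. Since `i_n R_{[1,n]}` fixes the range of `i_{k+1}` for `k < n`
(`ext_ext`), linearity (`ext_smul_add`) shows that each value of `K` is `i_n` of some vector. Its
first `n` coordinates in the spaces `X_k` cancel, which leaves `i_n(0, c)` with `c ∈ ℝ^{Γ_n}`, and
`Γ_n` is finite (`finite_gam`).

`U` has small norm. Its `X_k`-coordinate is `T_k z_k` for the first `n` spaces and `λ z_k`
afterwards, so at most `M ‖z‖`. A `γ`-coordinate is `λ z_γ` plus a coordinate of `i_n(w)`. By
`abs_ext_le` an extension is bounded by `A / μ + 2 B`, where `A` bounds the `X_k`-coordinates and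
`B` those on `Γ_n`. Here `B = 0` and `A = 2 M ‖z‖`, so `‖U‖ ≤ (1 + 2 / μ) M`, which is below the
claimed bound. -/

namespace AHLacunary

/-! ### Growth of the weights. -/

theorem four_le_of_one_le {m n : ℕ → ℕ} (h : AHLacunary m n) {j : ℕ} (hj : 1 ≤ j) : 4 ≤ m j := by
  induction j, hj using Nat.le_induction with
  | base => exact h.four_le
  | succ j hj ih => nlinarith [h.sq_le j hj]

theorem le_of_le {m n : ℕ → ℕ} (h : AHLacunary m n) {i j : ℕ} (hi : 1 ≤ i) (hij : i ≤ j) :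
    m i ≤ m j := by
  induction j, hij using Nat.le_induction with
  | base => exact le_rfl
  | succ j hj ih =>
    nlinarith [h.sq_le j (hi.trans hj), h.four_le_of_one_le (hi.trans hj)]

theorem le_subseq {m n : ℕ → ℕ} (h : AHLacunary m n) {L : Set ℕ} (hL : L.Infinite)
    (hL1 : ∀ j ∈ L, 1 ≤ j) (j : ℕ) : m (sInf L) ≤ subseq m L j := by
  have h1 : Nat.nth (fun i => i ∈ L) (j - 1) ∈ L := Nat.nth_mem_of_infinite hL _
  exact h.le_of_le (hL1 _ (Nat.sInf_mem hL.nonempty)) (Nat.sInf_le h1)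

end AHLacunary

namespace AHChoices

/-! ### Truncations and the finite sets `Γ_n`. -/

theorem trunc_trunc {X : ℕ → Type*} [∀ k, NormedAddCommGroup (X k)]
    {n p : ℕ} (x : ∀ k, X k) : trunc p (trunc n x) = trunc (min p n) x := by
  funext k
  simp only [trunc, lt_min_iff]
  split_ifs <;> first | rfl | omega

theorem norm_trunc_le {X : ℕ → Type*} [∀ k, NormedAddCommGroup (X k)]
    {n : ℕ} {x : ∀ k, X k} {A : ℝ} (hA : 0 ≤ A) (h : ∀ k, ‖x k‖ ≤ A) (k : ℕ) :
    ‖trunc n x k‖ ≤ A := by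
  rw [trunc]
  split_ifs
  · exact h k
  · simpa using hA

variable {X : ℕ → Type*} [∀ k, NormedAddCommGroup (X k)] [∀ k, NormedSpace ℝ (X k)]
variable {D : AHChoices X} {m ν : ℕ → ℕ} {L : Set ℕ}

theorem Allowed.rank_eq {n : ℕ} {G : Set ℕ} {x : AHNode} (h : D.Allowed m ν L n G x) :
    x.rank = n + 1 := by
  cases x with
  | base i => simp [AHNode.rank, h.1]
  | func s i => simp [AHNode.rank, h.1]
  | weighted s j a pred p b => cases pred <;> simp [AHNode.rank, h.1]

theorem gam_mono : Monotone (D.Gam m ν L) :=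
  monotone_nat_of_le_succ fun _ => Set.subset_union_left

theorem allowed_of_mem_gam {γ N : ℕ} (h : γ ∈ D.Gam m ν L N) :
    ∃ s, s < N ∧ D.rank γ = s + 1 ∧ D.Allowed m ν L s (D.Gam m ν L s) (D.label γ) := by
  induction N with
  | zero => exact h.elim
  | succ N ih =>
    rcases h with h | h
    · obtain ⟨s, hs, h⟩ := ih h
      exact ⟨s, hs.trans N.lt_succ_self, h⟩
    · exact ⟨N, N.lt_succ_self, Allowed.rank_eq h, h⟩

theorem allowed_of_mem_gamma {γ : ℕ} (h : γ ∈ D.Gamma m ν L) :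
    ∃ s, D.rank γ = s + 1 ∧ D.Allowed m ν L s (D.Gam m ν L s) (D.label γ) := by
  obtain ⟨N, h⟩ := Set.mem_iUnion.1 h
  obtain ⟨s, -, h⟩ := allowed_of_mem_gam h
  exact ⟨s, h⟩

theorem mem_gam_iff {γ N : ℕ} :
    γ ∈ D.Gam m ν L N ↔ γ ∈ D.Gamma m ν L ∧ D.rank γ ≤ N := by
  constructor
  · intro h
    obtain ⟨s, hs, hr, -⟩ := allowed_of_mem_gam h
    exact ⟨Set.mem_iUnion.2 ⟨N, h⟩, by omega⟩
  · rintro ⟨h, hN⟩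
    obtain ⟨s, hr, h⟩ := allowed_of_mem_gamma h
    exact gam_mono (show s + 1 ≤ N from hr ▸ hN) (show γ ∈ D.Gam m ν L (s + 1) from Or.inr h)

theorem finite_gam (n : ℕ) : (D.Gam m ν L n).Finite := by
  induction n with
  | zero => exact Set.finite_empty
  | succ n ih =>
    refine ih.union (Set.Finite.preimage D.label.injective.injOn
      (s := {x | D.Allowed m ν L n (D.Gam m ν L n) x}) ?_)
    set G := D.Gam m ν L n
    have hB : ((⋃ p ∈ Set.Iio n, (D.net p n : Set (ℕ →₀ ℚ))) ∪
        (fun η => Finsupp.single η (1 : ℚ)) '' G).Finite :=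
      ((Set.finite_Iio n).biUnion fun p _ => (D.net p n).finite_toSet).union (ih.image _)
    set B := (⋃ p ∈ Set.Iio n, (D.net p n : Set (ℕ →₀ ℚ))) ∪
        (fun η => Finsupp.single η (1 : ℚ)) '' G
    have hP : (insert none (some '' G)).Finite := (ih.image _).insert _
    set P := insert none (some '' G)
    -- The age is not a free parameter: it is one more than that of the predecessor, or `1` without
    -- one.
    have hfin : ((fun t : ℕ × Option ℕ × ℕ × (ℕ →₀ ℚ) => AHNode.weighted n t.1
        (t.2.1.elim 0 D.age + 1) t.2.1 t.2.2.1 t.2.2.2) ''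
        (Set.Iic (n + 1) ×ˢ P ×ˢ Set.Iio n ×ˢ B)).Finite :=
      ((Set.finite_Iic _).prod (hP.prod ((Set.finite_Iio _).prod hB))).image _
    refine ((((Set.finite_Iio D.card₁).image AHNode.base).union
      ((Set.finite_Iio (D.card₀ n)).image (AHNode.func n))).union hfin).subset ?_
    rintro x hx
    cases x with
    | base i => exact Or.inl (Or.inl ⟨i, hx.2, rfl⟩)
    | func s i => exact Or.inl (Or.inr ⟨i, hx.2.2, by rw [hx.1]⟩)
    | weighted s j a pred p b =>
      refine Or.inr ⟨(j, pred, p, b), ?_, ?_⟩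
      · cases pred with
        | none =>
          obtain ⟨-, -, hj, hp, -, -, hb⟩ := hx
          refine ⟨hj, Or.inl rfl, hp, ?_⟩
          rcases hb with ⟨-, hb⟩ | ⟨-, η, hη, -, rfl, -⟩
          · exact Or.inl (Set.mem_biUnion (Set.mem_Iio.2 hp) hb)
          · exact Or.inr ⟨η, hη, rfl⟩
        | some ξ =>
          obtain ⟨-, -, hj, hp, hξ, -, -, -, -, hb⟩ := hx
          refine ⟨hj, Or.inr ⟨ξ, hξ, rfl⟩, hp, ?_⟩
          rcases hb with ⟨-, hb⟩ | ⟨-, η, hη, -, rfl, -⟩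
          · exact Or.inl (Set.mem_biUnion (Set.mem_Iio.2 hp) hb)
          · exact Or.inr ⟨η, hη, rfl⟩
      · cases pred with
        | none => obtain ⟨rfl, -, -, -, rfl, -⟩ := hx; rfl
        | some ξ => obtain ⟨rfl, -, -, -, -, -, -, rfl, -⟩ := hx; rfl

/-! ### The extension operators: recursion, compatibility, linearity and bounds. -/

theorem extAux_congr {n : ℕ} {z w : D.Vec} (h1 : trunc n z.1 = trunc n w.1)
    (h2 : ∀ γ ∈ D.Gam m ν L n, z.2 γ = w.2 γ) (s : ℕ) :
    D.extAux m ν L s n z = D.extAux m ν L s n w := by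
  induction s with
  | zero =>
    funext γ
    simp only [extAux]
    split_ifs with h
    · exact h2 γ h
    · rfl
  | succ s ih =>
    funext γ
    simp only [extAux, ih, h1]

theorem ext_congr {n : ℕ} {z w : D.Vec} (h1 : trunc n z.1 = trunc n w.1)
    (h2 : ∀ γ ∈ D.Gam m ν L n, z.2 γ = w.2 γ) : D.ext m ν L n z = D.ext m ν L n w := by
  simp only [ext, h1, extAux_congr h1 h2]

theorem extAux_of_rank_le {s n γ : ℕ} (z : D.Vec) (h : D.rank γ ≤ s) :
    D.extAux m ν L s n z γ = (D.ext m ν L n z).2 γ := by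
  induction s, h using Nat.le_induction with
  | base => rfl
  | succ s hs ih => rw [extAux, if_neg (by omega), ih]

theorem extAux_of_notMem_gamma {s n γ : ℕ} (z : D.Vec) (h : γ ∉ D.Gamma m ν L) :
    D.extAux m ν L s n z γ = 0 := by
  induction s with
  | zero => rw [extAux, if_neg fun h' => h (mem_gam_iff.1 h').1]
  | succ s ih => rw [extAux, if_neg fun h' => h h'.1, ih]

theorem ext_of_notMem_gamma {n γ : ℕ} (z : D.Vec) (h : γ ∉ D.Gamma m ν L) :
    (D.ext m ν L n z).2 γ = 0 := extAux_of_notMem_gamma z h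

theorem ext_of_mem_gam {n γ : ℕ} (z : D.Vec) (h : γ ∈ D.Gam m ν L n) :
    (D.ext m ν L n z).2 γ = z.2 γ := by
  have key : ∀ s, D.extAux m ν L s n z γ = z.2 γ := by
    intro s
    induction s with
    | zero => rw [extAux, if_pos h]
    | succ s ih =>
      rw [extAux, if_neg, ih]
      have := (mem_gam_iff.1 h).2
      omega
  exact key _

/-- The three possible forms of `c*_γ` for `γ ∈ Γ` of rank `s + 1`. -/
theorem ext_cases (hmν : AHLacunary m ν) (hL : L.Infinite) (hL1 : ∀ j ∈ L, 1 ≤ j)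
    (hD : D.Admissible m ν L) {γ s : ℕ} (hγ : γ ∈ D.Gamma m ν L) (hs : D.rank γ = s + 1) :
    (∀ n ≤ s, ∀ z, (D.ext m ν L n z).2 γ = 0) ∨
    (∃ f : ∀ k, X k →L[ℝ] ℝ, ∑ k ∈ Finset.range s, ‖f k‖ ≤ 1 ∧
      ∀ n ≤ s, ∀ z, (D.ext m ν L n z).2 γ =
        (1 / (m (sInf L) : ℝ)) * ∑ k ∈ Finset.range s, f k ((D.ext m ν L n z).1 k)) ∨
    (∃ (p : ℕ) (μ : ℝ) (pred : Option ℕ) (b : ℕ →₀ ℚ), p < s ∧ (m (sInf L) : ℝ) ≤ μ ∧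
      (∀ ξ ∈ pred, ξ ∈ D.Gam m ν L p) ∧
      (∀ η ∈ b.support, η ∈ D.Gam m ν L s \ D.Gam m ν L p) ∧
      ∑ η ∈ b.support, |(b η : ℝ)| ≤ 1 ∧
      ∀ n ≤ s, ∀ z, (D.ext m ν L n z).2 γ = pred.elim 0 (D.ext m ν L n z).2 +
        (1 / μ) * ∑ η ∈ b.support, (b η : ℝ) *
          ((D.ext m ν L n z).2 η - (D.ext m ν L p (D.ext m ν L n z)).2 η)) := by
  obtain ⟨s', hs', hA⟩ := allowed_of_mem_gamma hγ
  obtain rfl : s = s' := by omega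
  have hext : ∀ n ≤ s, ∀ z, (D.ext m ν L n z).2 γ =
      D.cStar m L (fun p w => D.extAux m ν L s p w) γ
          (trunc n z.1, fun η => D.extAux m ν L s n z η) := by
    intro n hn z
    change D.extAux m ν L (D.rank γ) n z γ = _
    rw [hs, extAux, if_pos ⟨hγ, hs, by omega⟩]
  cases hlab : D.label γ with
  | base i =>
    left
    intro n hn z
    rw [hext n hn, cStar, hlab]
  | func t i =>
    rw [hlab] at hA
    obtain ⟨rfl, -, hi⟩ := hA
    refine Or.inr (Or.inl ⟨D.fn t i, hD.fn_ball t i hi, fun n hn z => ?_⟩)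
    rw [hext n hn, cStar, hlab]
    rfl
  | weighted t j a pred p b =>
    rw [hlab] at hA
    have hA' : t = s ∧ p < s ∧ (∀ ξ ∈ pred, ξ ∈ D.Gam m ν L p) ∧
        (b ∈ D.net p s ∨ ∃ η ∈ D.Gam m ν L s, p < D.rank η ∧ b = Finsupp.single η 1) := by
      cases pred with
      | none =>
        obtain ⟨ht, -, -, hp, -, -, hb⟩ := hA
        refine ⟨ht, hp, by simp, ?_⟩
        rcases hb with ⟨-, hb⟩ | ⟨-, η, hη, h, hb, -⟩
        · exact Or.inl hb
        · exact Or.inr ⟨η, hη, h, hb⟩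
      | some ξ =>
        obtain ⟨ht, -, -, hp, hξ, -, -, -, hcut, hb⟩ := hA
        refine ⟨ht, hp, ?_, ?_⟩
        · rintro _ ⟨⟩
          -- Admissible cuts satisfy `rank ξ ≤ p`, so the predecessor lies in `Γ_p` and not merely
          -- in `Γ_s`.
          exact mem_gam_iff.2 ⟨(mem_gam_iff.1 hξ).1, hD.le_of_cut _ _ hcut⟩
        rcases hb with ⟨-, hb⟩ | ⟨-, η, hη, h, hb, -⟩
        · exact Or.inl hb
        · exact Or.inr ⟨η, hη, h, hb⟩
    obtain ⟨rfl, hp, hpred, hb⟩ := hA'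
    have hsupp : ∀ η ∈ b.support, η ∈ D.Gam m ν L t \ D.Gam m ν L p := by
      rcases hb with hb | ⟨η, hη, hr, rfl⟩
      · exact hD.net_support p t hp b hb
      · intro η' hη'
        obtain rfl : η' = η := by
          simpa using Finsupp.support_single_subset hη'
        exact ⟨hη, fun h => absurd (mem_gam_iff.1 h).2 (by omega)⟩
    have hball : ∑ η ∈ b.support, |(b η : ℝ)| ≤ 1 := by
      rcases hb with hb | ⟨η, hη, hr, rfl⟩
      · exact_mod_cast hD.net_ball p t hp b hb
      · simp [Finsupp.support_single]
    refine Or.inr (Or.inr ⟨p, subseq m L j, pred, b, hp,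
      by exact_mod_cast hmν.le_subseq hL hL1 j, hpred, hsupp, hball, fun n hn z => ?_⟩)
    rw [hext n hn, cStar, hlab]
    have e1 : ∀ η ∈ D.Gam m ν L t, D.extAux m ν L t n z η = (D.ext m ν L n z).2 η :=
      fun η hη => extAux_of_rank_le z (mem_gam_iff.1 hη).2
    dsimp only
    congr 1
    · cases pred with
      | none => rfl
      | some ξ => exact e1 ξ (gam_mono hp.le (hpred ξ rfl))
    · congr 1
      refine Finset.sum_congr rfl fun η hη => ?_
      have hη := (hsupp η hη).1
      rw [e1 η hη, extAux_of_rank_le _ (mem_gam_iff.1 hη).2]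
      -- `i_p` sees only the first `p` coordinates, where the partially built vector already equals
      -- `i_n z`.
      congr 2
      exact congrFun (congrArg Prod.snd
        (ext_congr (z := (trunc n z.1, fun η => D.extAux m ν L t n z η)) (w := D.ext m ν L n z)
        rfl fun ζ hζ => e1 ζ (gam_mono hp.le hζ))) η

/-- Both sides agree on `Γ_p` and obey the same recursion at every rank above `p`, so strong
induction on the rank applies. Consequently `P_{(p,s]}` annihilates the range of `i_n` when `n ≤ p`.
-/
theorem ext_ext (hmν : AHLacunary m ν) (hL : L.Infinite) (hL1 : ∀ j ∈ L, 1 ≤ j)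
    (hD : D.Admissible m ν L) {n p : ℕ} (hnp : n ≤ p) (z : D.Vec) :
    D.ext m ν L p (D.ext m ν L n z) = D.ext m ν L n z := by
  have h1 : (D.ext m ν L p (D.ext m ν L n z)).1 = (D.ext m ν L n z).1 := by
    change trunc p (trunc n z.1) = trunc n z.1
    rw [trunc_trunc, min_eq_right hnp]
  refine Prod.ext h1 (funext fun γ => ?_)
  induction hr : D.rank γ using Nat.strong_induction_on generalizing γ with
  | _ r ih =>
  by_cases hγ : γ ∈ D.Gamma m ν L
  swap
  · rw [ext_of_notMem_gamma _ hγ, ext_of_notMem_gamma _ hγ]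
  by_cases hp : γ ∈ D.Gam m ν L p
  · exact ext_of_mem_gam _ hp
  obtain ⟨s, hs, -⟩ := allowed_of_mem_gamma hγ
  have hps : p ≤ s := by
    by_contra h
    exact hp (mem_gam_iff.2 ⟨hγ, by omega⟩)
  have ih' : ∀ η ∈ D.Gam m ν L s,
      (D.ext m ν L p (D.ext m ν L n z)).2 η = (D.ext m ν L n z).2 η := fun η hη =>
    ih _ (by have := (mem_gam_iff.1 hη).2; omega) η rfl
  rcases ext_cases hmν hL hL1 hD hγ hs with h | ⟨f, -, h⟩ | ⟨q, μ, pred, b, hq, -, hpred, hb, -, h⟩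
  · rw [h p hps, h n (hnp.trans hps)]
  · rw [h p hps, h n (hnp.trans hps), h1]
  · rw [h p hps, h n (hnp.trans hps), ext_congr (n := q) (congrArg (trunc q) h1)
      fun ζ hζ => ih' ζ (gam_mono hq.le hζ)]
    congr 1
    · cases pred with
      | none => rfl
      | some ξ => exact ih' ξ (gam_mono hq.le (hpred ξ rfl))
    · congr 1
      exact Finset.sum_congr rfl fun η hη => by rw [ih' η (hb η hη).1]

theorem trunc_add_smul (n : ℕ) (a : ℝ) (x y : ∀ k, X k) :
    trunc n (a • x + y) = a • trunc n x + trunc n y := by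
  funext k
  simp only [trunc, Pi.add_apply, Pi.smul_apply]
  split_ifs <;> simp

theorem ext_smul_add (hmν : AHLacunary m ν) (hL : L.Infinite) (hL1 : ∀ j ∈ L, 1 ≤ j)
    (hD : D.Admissible m ν L) (n : ℕ) (a : ℝ) (z w : D.Vec) :
    D.ext m ν L n (a • z + w) = a • D.ext m ν L n z + D.ext m ν L n w := by
  refine Prod.ext (trunc_add_smul n a z.1 w.1) (funext fun γ => ?_)
  induction hr : D.rank γ using Nat.strong_induction_on generalizing γ n z w with
  | _ r ih =>
  simp only [Prod.snd_add, Prod.smul_snd, Pi.add_apply, Pi.smul_apply, smul_eq_mul]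
  simp only [Prod.snd_add, Prod.smul_snd, Pi.add_apply, Pi.smul_apply, smul_eq_mul] at ih
  by_cases hγ : γ ∈ D.Gamma m ν L
  swap
  · simp only [ext_of_notMem_gamma _ hγ, mul_zero, add_zero]
  by_cases hn : γ ∈ D.Gam m ν L n
  · simp only [ext_of_mem_gam _ hn]
    rfl
  obtain ⟨s, hs, -⟩ := allowed_of_mem_gamma hγ
  have hns : n ≤ s := by
    by_contra h
    exact hn (mem_gam_iff.2 ⟨hγ, by omega⟩)
  have ih' : ∀ q z w, ∀ η ∈ D.Gam m ν L s, (D.ext m ν L q (a • z + w)).2 η =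
      a * (D.ext m ν L q z).2 η + (D.ext m ν L q w).2 η := fun q z w η hη =>
    ih _ (by have := (mem_gam_iff.1 hη).2; omega) q z w η rfl
  have h1 : (D.ext m ν L n (a • z + w)).1 = a • (D.ext m ν L n z).1 + (D.ext m ν L n w).1 :=
    trunc_add_smul n a z.1 w.1
  rcases ext_cases hmν hL hL1 hD hγ hs with h | ⟨f, -, h⟩ | ⟨q, μ, pred, b, hq, -, hpred, hb, -, h⟩
  · simp only [h n hns, mul_zero, add_zero]
  · simp only [h n hns, h1, Pi.add_apply, Pi.smul_apply, map_add, map_smul, smul_eq_mul,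
      Finset.sum_add_distrib, ← Finset.mul_sum]
    ring
  · have e : D.ext m ν L q (D.ext m ν L n (a • z + w)) =
        D.ext m ν L q (a • D.ext m ν L n z + D.ext m ν L n w) :=
      ext_congr (congrArg (trunc q) h1) fun ζ hζ => ih' n z w ζ (gam_mono hq.le hζ)
    have e2 : pred.elim 0 (D.ext m ν L n (a • z + w)).2 =
        a * pred.elim 0 (D.ext m ν L n z).2 + pred.elim 0 (D.ext m ν L n w).2 := by
      cases pred with
      | none => simp
      | some ξ => exact ih' n z w ξ (gam_mono hq.le (hpred ξ rfl))
    rw [h n hns, h n hns z, h n hns w, e, e2]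
    have e3 : ∑ η ∈ b.support, (b η : ℝ) * ((D.ext m ν L n (a • z + w)).2 η -
          (D.ext m ν L q (a • D.ext m ν L n z + D.ext m ν L n w)).2 η) =
        a * ∑ η ∈ b.support, (b η : ℝ) * ((D.ext m ν L n z).2 η -
          (D.ext m ν L q (D.ext m ν L n z)).2 η) +
        ∑ η ∈ b.support, (b η : ℝ) * ((D.ext m ν L n w).2 η -
          (D.ext m ν L q (D.ext m ν L n w)).2 η) := by
      rw [Finset.mul_sum, ← Finset.sum_add_distrib]
      refine Finset.sum_congr rfl fun η hη => ?_
      rw [ih' n z w η (hb η hη).1, ih' q _ _ η (hb η hη).1]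
      ring
    rw [e3]
    ring

/-- The `X_k`-coordinates enter only through the functionals `f`, which carry the factor `1 / m
(sInf L)`. In a weighted coordinate with `n ≤ p` the projection term vanishes and the bound passes
from the predecessor. With `p < n` the predecessor lies in `Γ_n` and contributes at most `B`, while
weights at least `4` leave at most `(1/4) · 2 (A / m (sInf L) + 2 B)` for the rest. -/
theorem abs_ext_le (hmν : AHLacunary m ν) (hL : L.Infinite) (hL1 : ∀ j ∈ L, 1 ≤ j)
    (hD : D.Admissible m ν L) {A B : ℝ} (hA : 0 ≤ A) (hB : 0 ≤ B) (n : ℕ) (z : D.Vec)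
    (h1 : ∀ k, ‖z.1 k‖ ≤ A) (h2 : ∀ γ ∈ D.Gam m ν L n, |z.2 γ| ≤ B) (γ : ℕ) :
    |(D.ext m ν L n z).2 γ| ≤ A / m (sInf L) + 2 * B := by
  have hm : (4 : ℝ) ≤ m (sInf L) := by
    exact_mod_cast hmν.four_le_of_one_le (hL1 _ (Nat.sInf_mem hL.nonempty))
  have hAm : 0 ≤ A / m (sInf L) := by positivity
  induction hr : D.rank γ using Nat.strong_induction_on generalizing γ n with
  | _ r ih =>
  by_cases hγ : γ ∈ D.Gamma m ν L
  swap
  · rw [ext_of_notMem_gamma _ hγ, abs_zero]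
    positivity
  by_cases hn : γ ∈ D.Gam m ν L n
  · rw [ext_of_mem_gam _ hn]
    linarith [h2 γ hn]
  obtain ⟨s, hs, -⟩ := allowed_of_mem_gamma hγ
  have hns : n ≤ s := by
    by_contra h
    exact hn (mem_gam_iff.2 ⟨hγ, by omega⟩)
  rcases ext_cases hmν hL hL1 hD hγ hs with h | ⟨f, hf, h⟩ |
    ⟨q, μ, pred, b, hq, hμ, hpred, hb, hb1, h⟩
  · rw [h n hns, abs_zero]
    positivity
  · have hsum : |∑ k ∈ Finset.range s, f k ((D.ext m ν L n z).1 k)| ≤ A :=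
      calc |∑ k ∈ Finset.range s, f k ((D.ext m ν L n z).1 k)|
          ≤ ∑ k ∈ Finset.range s, ‖f k‖ * A := by
            refine (Finset.abs_sum_le_sum_abs _ _).trans (Finset.sum_le_sum fun k _ => ?_)
            exact (f k).le_opNorm_of_le (norm_trunc_le hA h1 k)
        _ = (∑ k ∈ Finset.range s, ‖f k‖) * A := (Finset.sum_mul _ _ _).symm
        _ ≤ A := mul_le_of_le_one_left hA hf
    rw [h n hns, abs_mul, abs_of_pos (by positivity : (0 : ℝ) < 1 / m (sInf L)),
      one_div_mul_eq_div]
    have : |∑ k ∈ Finset.range s, f k ((D.ext m ν L n z).1 k)| / m (sInf L) ≤ A / m (sInf L) := by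
      gcongr
    linarith
  · rw [h n hns]
    rcases le_or_gt n q with hnq | hqn
    · simp only [ext_ext hmν hL hL1 hD hnq, sub_self, mul_zero, Finset.sum_const_zero, add_zero]
      cases pred with
      | none =>
        simp only [Option.elim_none, abs_zero]
        positivity
      | some ξ =>
        refine ih (D.rank ξ) ?_ n h2 ξ rfl
        have := (mem_gam_iff.1 (hpred ξ rfl)).2
        omega
    · have e : D.ext m ν L q (D.ext m ν L n z) = D.ext m ν L q z := by
        refine ext_congr ?_ fun ζ hζ => ext_of_mem_gam _ (gam_mono hqn.le hζ)
        change trunc q (trunc n z.1) = _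
        rw [trunc_trunc, min_eq_left hqn.le]
      rw [e]
      have hpr : |pred.elim 0 (D.ext m ν L n z).2| ≤ B := by
        cases pred with
        | none => simpa using hB
        | some ξ =>
          have hξ := gam_mono hqn.le (hpred ξ rfl)
          simpa only [Option.elim_some, ext_of_mem_gam _ hξ] using h2 ξ hξ
      have hsum : |∑ η ∈ b.support, (b η : ℝ) *
          ((D.ext m ν L n z).2 η - (D.ext m ν L q z).2 η)| ≤ 2 * (A / m (sInf L) + 2 * B) :=
        calc |∑ η ∈ b.support, (b η : ℝ) * ((D.ext m ν L n z).2 η - (D.ext m ν L q z).2 η)|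
            ≤ ∑ η ∈ b.support, |(b η : ℝ)| * (2 * (A / m (sInf L) + 2 * B)) := by
              refine (Finset.abs_sum_le_sum_abs _ _).trans (Finset.sum_le_sum fun η hη => ?_)
              rw [abs_mul]
              refine mul_le_mul_of_nonneg_left ?_ (abs_nonneg _)
              have hη := (mem_gam_iff.1 (hb η hη).1).2
              have i1 := ih _ (by omega) n h2 η rfl
              have i2 := ih _ (by omega) q (fun ζ hζ => h2 ζ (gam_mono hqn.le hζ)) η rfl
              exact (abs_sub _ _).trans (by linarith)
          _ = (∑ η ∈ b.support, |(b η : ℝ)|) * (2 * (A / m (sInf L) + 2 * B)) :=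
              (Finset.sum_mul _ _ _).symm
          _ ≤ 2 * (A / m (sInf L) + 2 * B) := mul_le_of_le_one_left (by positivity) hb1
      have hμ4 : 1 / μ ≤ 1 / 4 := one_div_le_one_div_of_le (by norm_num) (hm.trans hμ)
      have hμ0 : 0 ≤ 1 / μ := by
        have : 0 ≤ μ := by linarith
        positivity
      refine (abs_add_le _ _).trans ?_
      rw [abs_mul, abs_of_nonneg hμ0]
      have := mul_le_mul hμ4 hsum (abs_nonneg _) (by norm_num)
      linarith

/-! ### From formal vectors to bounded operators on `Z_∞`. -/

theorem coords_injective : Function.Injective (D.coords m ν L) := by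
  intro z w h
  refine Prod.ext (lp.ext (congrArg Prod.fst h)) (lp.ext (funext fun γ => ?_))
  have := congrFun (congrArg Prod.snd h) γ
  simpa [coords] using this

theorem coords_smul_add (a : ℝ) (z w : D.ZInfty m ν L) :
    D.coords m ν L (a • z + w) = a • D.coords m ν L z + D.coords m ν L w := by
  refine Prod.ext rfl (funext fun γ => ?_)
  by_cases h : γ ∈ D.Gamma m ν L
  · simp only [coords, h, dif_pos, Prod.snd_add, Prod.smul_snd, Pi.add_apply, Pi.smul_apply]
    rfl
  · simp [coords, h]

variable (D m ν L) in
/-- The coordinates of an element of `Z_∞`, as a linear map. -/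
noncomputable def coordsL : D.ZInfty m ν L →ₗ[ℝ] D.Vec where
  toFun := D.coords m ν L
  map_add' z w := by simpa using coords_smul_add 1 z w
  map_smul' a z := by
    have h0 : D.coords m ν L 0 = 0 := by
      have := coords_smul_add (D := D) (m := m) (ν := ν) (L := L) 1 0 0
      simpa using this
    simpa [h0] using coords_smul_add a z 0

@[simp] theorem coordsL_apply (z : D.ZInfty m ν L) : coordsL D m ν L z = D.coords m ν L z := rfl

theorem norm_coords_fst_le (z : D.ZInfty m ν L) (k : ℕ) : ‖(D.coords m ν L z).1 k‖ ≤ ‖z‖ :=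
  (lp.norm_apply_le_norm ENNReal.top_ne_zero z.1 k).trans (norm_fst_le z)

theorem abs_coords_snd_le (z : D.ZInfty m ν L) (γ : ℕ) : |(D.coords m ν L z).2 γ| ≤ ‖z‖ := by
  by_cases h : γ ∈ D.Gamma m ν L
  · simp only [coords, h, dif_pos]
    exact (lp.norm_apply_le_norm ENNReal.top_ne_zero z.2 ⟨γ, h⟩).trans (norm_snd_le z)
  · simp [coords, h]

theorem norm_le_of_coords {z : D.ZInfty m ν L} {C : ℝ} (hC : 0 ≤ C)
    (h1 : ∀ k, ‖(D.coords m ν L z).1 k‖ ≤ C) (h2 : ∀ γ, |(D.coords m ν L z).2 γ| ≤ C) :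
    ‖z‖ ≤ C := by
  refine max_le (lp.norm_le_of_forall_le hC h1) (lp.norm_le_of_forall_le hC fun γ => ?_)
  simpa [coords] using h2 γ

theorem exists_coords_eq {v : D.Vec} {C : ℝ} (h1 : ∀ k, ‖v.1 k‖ ≤ C) (h2 : ∀ γ, |v.2 γ| ≤ C)
    (h3 : ∀ γ, γ ∉ D.Gamma m ν L → v.2 γ = 0) : ∃ z, D.coords m ν L z = v := by
  refine ⟨(⟨v.1, memℓp_infty ⟨C, ?_⟩⟩, ⟨fun γ => v.2 γ, memℓp_infty ⟨C, ?_⟩⟩), ?_⟩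
  · rintro _ ⟨k, rfl⟩
    exact h1 k
  · rintro _ ⟨γ, rfl⟩
    exact h2 γ
  · refine Prod.ext rfl (funext fun γ => ?_)
    by_cases h : γ ∈ D.Gamma m ν L
    · simp [coords, h]
    · simp [coords, h, h3 γ h]

/-- A linear map on formal vectors that is bounded on `Z_∞` acts on `Z_∞`. -/
theorem exists_lift (Φ : D.Vec →ₗ[ℝ] D.Vec) {C : ℝ}
    (h1 : ∀ z k, ‖(Φ (D.coords m ν L z)).1 k‖ ≤ C * ‖z‖)
    (h2 : ∀ z γ, |(Φ (D.coords m ν L z)).2 γ| ≤ C * ‖z‖)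
    (h3 : ∀ z γ, γ ∉ D.Gamma m ν L → (Φ (D.coords m ν L z)).2 γ = 0) :
    ∃ Ψ : D.ZInfty m ν L →L[ℝ] D.ZInfty m ν L,
      ∀ z, D.coords m ν L (Ψ z) = Φ (D.coords m ν L z) := by
  choose ψ hψ using fun z => exists_coords_eq (h1 z) (h2 z) (h3 z)
  let Ψ : D.ZInfty m ν L →ₗ[ℝ] D.ZInfty m ν L :=
    { toFun := ψ
      map_add' := fun z w => coords_injective <| by
        simp only [hψ, ← coordsL_apply, map_add]
        simp [hψ]
      map_smul' := fun a z => coords_injective <| by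
        simp only [hψ, ← coordsL_apply, map_smul]
        simp [hψ] }
  refine ⟨Ψ.mkContinuous C fun z => ?_, hψ⟩
  refine norm_le_of_coords ((norm_nonneg _).trans (h1 z 0)) (fun k => ?_) fun γ => ?_
  · exact (congrArg (fun v : D.Vec => ‖v.1 k‖) (hψ z)).trans_le (h1 z k)
  · exact (congrArg (fun v : D.Vec => |v.2 γ|) (hψ z)).trans_le (h2 z γ)

theorem ext_zero (hmν : AHLacunary m ν) (hL : L.Infinite) (hL1 : ∀ j ∈ L, 1 ≤ j)
    (hD : D.Admissible m ν L) (n : ℕ) : D.ext m ν L n 0 = 0 := by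
  simpa using ext_smul_add hmν hL hL1 hD n 1 0 0

/-- The operator `i_n ∘ R_{[1,n]}` on formal vectors. -/
noncomputable def extL (hmν : AHLacunary m ν) (hL : L.Infinite) (hL1 : ∀ j ∈ L, 1 ≤ j)
    (hD : D.Admissible m ν L) (n : ℕ) : D.Vec →ₗ[ℝ] D.Vec where
  toFun := D.ext m ν L n
  map_add' z w := by simpa using ext_smul_add hmν hL hL1 hD n 1 z w
  map_smul' a z := by
    simpa [ext_zero hmν hL hL1 hD n] using ext_smul_add hmν hL hL1 hD n a z 0

theorem exists_ext_operator (hmν : AHLacunary m ν) (hL : L.Infinite) (hL1 : ∀ j ∈ L, 1 ≤ j)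
    (hD : D.Admissible m ν L) (n : ℕ) :
    ∃ J : D.ZInfty m ν L →L[ℝ] D.ZInfty m ν L,
      ∀ z, D.coords m ν L (J z) = D.ext m ν L n (D.coords m ν L z) := by
  have hm : (4 : ℝ) ≤ m (sInf L) := by
    exact_mod_cast hmν.four_le_of_one_le (hL1 _ (Nat.sInf_mem hL.nonempty))
  refine exists_lift (extL hmν hL hL1 hD n) (C := 3) (fun z k => ?_) (fun z γ => ?_)
    fun z γ => ext_of_notMem_gamma _
  · have := norm_trunc_le (n := n) (norm_nonneg z) (norm_coords_fst_le z) k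
    change ‖trunc n (D.coords m ν L z).1 k‖ ≤ 3 * ‖z‖
    linarith [norm_nonneg z]
  · refine (abs_ext_le hmν hL hL1 hD (norm_nonneg z) (norm_nonneg z) n _ (norm_coords_fst_le z)
      (fun γ _ => abs_coords_snd_le z γ) γ).trans ?_
    have : ‖z‖ / m (sInf L) ≤ ‖z‖ := div_le_self (norm_nonneg z) (by linarith)
    linarith

theorem exists_diagonal_operator (A : ∀ k, X k →L[ℝ] X k) {C : ℝ} (hA : ∀ k, ‖A k‖ ≤ C) :
    ∃ W : D.ZInfty m ν L →L[ℝ] D.ZInfty m ν L,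
      ∀ z, D.coords m ν L (W z) = (fun k => A k (z.1 k), 0) := by
  have hC : 0 ≤ C := (norm_nonneg _).trans (hA 0)
  let Φ : D.Vec →ₗ[ℝ] D.Vec :=
    { toFun := fun v => (fun k => A k (v.1 k), 0)
      map_add' := fun v w => by ext <;> simp
      map_smul' := fun a v => by ext <;> simp }
  refine exists_lift Φ (C := C) (fun z k => ?_) (fun z γ => ?_) fun z γ _ => rfl
  · exact (A k).le_of_opNorm_le_of_le (hA k) (norm_coords_fst_le z k)
  · change |(0 : ℝ)| ≤ _
    rw [abs_zero]
    positivity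

theorem mem_space_of_coords_eq_ext {z : D.ZInfty m ν L} {n : ℕ} {u : D.Vec}
    (h : D.coords m ν L z = D.ext m ν L n u) : z ∈ D.space m ν L :=
  Submodule.le_topologicalClosure _
    (Submodule.subset_span (Set.mem_iUnion.2 ⟨n, u, h⟩))

end AHChoices

/-! ### Finite-rank operators and the approximation of `T`. -/

theorem ContinuousLinearMap.isCompactOperator_of_finiteDimensional_range {E F : Type*}
    [NormedAddCommGroup E] [NormedSpace ℝ E] [NormedAddCommGroup F] [NormedSpace ℝ F]
    (K : E →L[ℝ] F) [FiniteDimensional ℝ (LinearMap.range (K : E →ₗ[ℝ] F))] :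
    IsCompactOperator K := by
  have : ProperSpace (LinearMap.range (K : E →ₗ[ℝ] F)) := FiniteDimensional.proper ℝ _
  have h := (isCompactOperator_of_locallyCompactSpace_dom
    (K.codRestrict (LinearMap.range (K : E →ₗ[ℝ] F)) fun x => ⟨x, rfl⟩))
  exact h.clm_comp (LinearMap.range (K : E →ₗ[ℝ] F)).subtypeL

theorem LinearMap.finiteDimensional_range_of_comp {E F V : Type*} [AddCommGroup E] [Module ℝ E]
    [AddCommGroup F] [Module ℝ F] [AddCommGroup V] [Module ℝ V] [FiniteDimensional ℝ V]
    (K : E →ₗ[ℝ] F) (ρ : F →ₗ[ℝ] V) (h : ∀ x, ρ (K x) = 0 → K x = 0) :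
    FiniteDimensional ℝ (LinearMap.range K) := by
  refine FiniteDimensional.of_injective (ρ.comp (LinearMap.range K).subtype)
    ((injective_iff_map_eq_zero _).2 ?_)
  rintro ⟨_, x, rfl⟩ h0
  exact Subtype.ext (h x h0)

set_option maxHeartbeats 1000000 in
open AHChoices in
theorem mainTheorem10 {X : ℕ → Type*} [∀ k, NormedAddCommGroup (X k)]
    [∀ k, NormedSpace ℝ (X k)] [∀ k, CompleteSpace (X k)]
    [∀ k, TopologicalSpace.SeparableSpace (X k)]
    (m ν : ℕ → ℕ) (hmν : AHLacunary m ν)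
    (L : Set ℕ) (hL : L.Infinite) (hL1 : ∀ j ∈ L, 1 ≤ j)
    (D : AHChoices X) (hD : D.Admissible m ν L)
    (n : ℕ) (T : ∀ k : Fin n, X k →L[ℝ] X k) (lam : ℝ) :
    ∃ S : D.space m ν L →L[ℝ] D.space m ν L,
      (∀ z : D.space m ν L,
        D.coords m ν L (S z) = D.diag m ν L n T lam (D.coords m ν L z)) ∧
      ∃ K : D.space m ν L →L[ℝ] D.space m ν L,
        IsCompactOperator K ∧
        FiniteDimensional ℝ (LinearMap.range (K : D.space m ν L →ₗ[ℝ] D.space m ν L)) ∧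
        ‖S - K‖ ≤ (1 + 4 / ((m (sInf L) : ℝ) - 2)) *
          max (((Finset.univ.sup fun k => ‖T k‖₊ : ℝ≥0) : ℝ)) |lam| := by
  set M : ℝ := max (((Finset.univ.sup fun k => ‖T k‖₊ : ℝ≥0) : ℝ)) |lam| with hM
  have hTM : ∀ k, ‖T k‖ ≤ M := fun k => le_max_of_le_left <| by
    exact_mod_cast Finset.le_sup (f := fun k => ‖T k‖₊) (Finset.mem_univ k)
  have hlM : |lam| ≤ M := le_max_right _ _
  have hM0 : 0 ≤ M := (abs_nonneg _).trans hlM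
  have hm : (4 : ℝ) ≤ m (sInf L) := by
    exact_mod_cast hmν.four_le_of_one_le (hL1 _ (Nat.sInf_mem hL.nonempty))
  choose J hJ using exists_ext_operator hmν hL hL1 hD
  -- With `λ` beyond the first `n` spaces, `T' k - λ` vanishes there, and `T'` describes the action
  -- of `UZ` on all `X_k`-coordinates.
  let T' : ∀ k, X k →L[ℝ] X k := fun k => if h : k < n then T ⟨k, h⟩ else lam • .id ℝ (X k)
  have hid : ∀ k, ‖lam • ContinuousLinearMap.id ℝ (X k)‖ ≤ M := fun k => by
    rw [norm_smul, Real.norm_eq_abs]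
    exact (mul_le_of_le_one_right (abs_nonneg _) ContinuousLinearMap.norm_id_le).trans hlM
  have hT' : ∀ k, ‖T' k‖ ≤ M := fun k => by
    by_cases h : k < n
    · simpa only [T', h, dif_pos] using hTM ⟨k, h⟩
    · simpa only [T', h, dif_neg, not_false_eq_true] using hid k
  have hW2 : ∀ k, ‖T' k - lam • .id ℝ (X k)‖ ≤ 2 * M := fun k =>
    (norm_sub_le _ _).trans (by linarith [hT' k, hid k])
  obtain ⟨W, hW⟩ := exists_diagonal_operator (D := D) (m := m) (ν := ν) (L := L) _ hW2
  have hA : ∀ k : Fin n, ∃ A : D.ZInfty m ν L →L[ℝ] D.ZInfty m ν L,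
      ∀ z, D.coords m ν L (A z) = (Pi.single (k : ℕ) (T k (z.1 k)), 0) := by
    intro k
    obtain ⟨A, hA⟩ := exists_diagonal_operator (D := D) (m := m) (ν := ν) (L := L)
      (Pi.single (k : ℕ) (T k)) (C := ‖T k‖) (fun i => by
        rcases eq_or_ne i k with rfl | h
        · simp
        · simp [h])
    refine ⟨A, fun z => (hA z).trans (Prod.ext (funext fun i => ?_) rfl)⟩
    rcases eq_or_ne i k with rfl | h
    · simp
    · simp [h]
  choose A hA using hA
  let SZ : D.ZInfty m ν L →L[ℝ] D.ZInfty m ν L :=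
    ∑ k : Fin n, (J (k + 1)).comp (A k) + lam • (.id ℝ _ - J n)
  let UZ : D.ZInfty m ν L →L[ℝ] D.ZInfty m ν L := lam • .id ℝ _ + (J n).comp W
  have hJmem : ∀ n z, J n z ∈ D.space m ν L := fun n z => mem_space_of_coords_eq_ext (hJ n z)
  have hSmem : ∀ z : D.space m ν L, SZ z ∈ D.space m ν L := fun z => by
    simp only [SZ, add_apply, sum_apply,
      ContinuousLinearMap.comp_apply, smul_apply,
      sub_apply, ContinuousLinearMap.id_apply]
    exact add_mem (sum_mem fun k _ => hJmem _ _)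
      (Submodule.smul_mem _ _ (sub_mem z.2 (hJmem _ _)))
  have hUmem : ∀ z : D.space m ν L, UZ z ∈ D.space m ν L := fun z =>
    add_mem (Submodule.smul_mem _ _ z.2) (hJmem _ _)
  obtain ⟨S, hS⟩ : ∃ S : D.space m ν L →L[ℝ] D.space m ν L,
      ∀ z, (S z : D.ZInfty m ν L) = SZ z :=
    ⟨(SZ.comp (D.space m ν L).subtypeL).codRestrict _ hSmem, fun _ => rfl⟩
  obtain ⟨U, hU⟩ : ∃ U : D.space m ν L →L[ℝ] D.space m ν L,
      ∀ z, (U z : D.ZInfty m ν L) = UZ z :=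
    ⟨(UZ.comp (D.space m ν L).subtypeL).codRestrict _ hUmem, fun _ => rfl⟩
  have hUnorm : ∀ z, ‖UZ z‖ ≤ (1 + 4 / ((m (sInf L) : ℝ) - 2)) * M * ‖z‖ := by
    intro z
    have hz := norm_nonneg z
    have hc : M * ‖z‖ + 2 * M * ‖z‖ / m (sInf L) ≤
        (1 + 4 / ((m (sInf L) : ℝ) - 2)) * M * ‖z‖ := by
      -- The argument yields the constant `1 + 2 / m (sInf L)`, which is then weakened to the stated
      -- one.
      have : 2 / (m (sInf L) : ℝ) ≤ 4 / ((m (sInf L) : ℝ) - 2) := by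
        rw [div_le_div_iff₀ (by linarith) (by linarith)]
        linarith
      have := mul_le_mul_of_nonneg_right this (mul_nonneg hM0 hz)
      calc M * ‖z‖ + 2 * M * ‖z‖ / m (sInf L) = M * ‖z‖ + 2 / m (sInf L) * (M * ‖z‖) := by ring
        _ ≤ M * ‖z‖ + 4 / ((m (sInf L) : ℝ) - 2) * (M * ‖z‖) := by linarith
        _ = _ := by ring
    have hc1 : M * ‖z‖ ≤ (1 + 4 / ((m (sInf L) : ℝ) - 2)) * M * ‖z‖ :=
      le_trans (le_add_of_nonneg_right (by positivity)) hc
    have hcoord : D.coords m ν L (UZ z) = lam • D.coords m ν L z +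
        D.ext m ν L n (fun k => (T' k - lam • .id ℝ (X k)) (z.1 k), 0) := by
      rw [← hW, ← hJ]
      exact coords_smul_add lam z (J n (W z))
    refine norm_le_of_coords ((mul_nonneg hM0 hz).trans hc1) (fun k => ?_) fun γ => ?_
    · have : (D.coords m ν L (UZ z)).1 k = T' k (z.1 k) := by
        rw [hcoord]
        change lam • z.1 k + trunc n _ k = _
        by_cases h : k < n
        · simp [trunc, h]
        · simp [trunc, h, T']
      rw [this]
      exact ((T' k).le_of_opNorm_le_of_le (hT' k) (norm_coords_fst_le z k)).trans hc1
    · rw [hcoord]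
      have h1 : |lam * (D.coords m ν L z).2 γ| ≤ M * ‖z‖ := by
        rw [abs_mul]
        exact mul_le_mul hlM (abs_coords_snd_le z γ) (abs_nonneg _) hM0
      -- `B = 0` because the extended vector is zero on `Γ_n`; only the term with the factor `1 / m
      -- (sInf L)` survives.
      have h2 := abs_ext_le hmν hL hL1 hD (A := 2 * M * ‖z‖) (B := 0) (by positivity) le_rfl n
        (fun k => (T' k - lam • .id ℝ (X k)) (z.1 k), 0)
        (fun k => ContinuousLinearMap.le_of_opNorm_le_of_le _ (hW2 k) (norm_coords_fst_le z k))
        (by simp) γ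
      exact (abs_add_le _ _).trans ((add_le_add h1 (h2.trans_eq (by ring))).trans hc)
  have hScoords : ∀ z, D.coords m ν L (SZ z) = D.diag m ν L n T lam (D.coords m ν L z) := by
    intro z
    simp only [← coordsL_apply, SZ, diag, add_apply,
      sum_apply, ContinuousLinearMap.comp_apply,
      smul_apply, sub_apply,
      ContinuousLinearMap.id_apply, map_add, map_sum, map_smul, map_sub]
    simp only [coordsL_apply, hJ, hA]
    rfl
  -- every value of `S - U` is of the form `i_n(0, c)`
  have hK : ∀ z, ∃ w : D.Vec, trunc n w.1 = 0 ∧ D.coords m ν L (SZ z - UZ z) = D.ext m ν L n w := by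
    intro z
    -- The terms `λ z` of `SZ z` and `UZ z` cancel. The remaining terms are values of `i_n`, the sum
    -- being fixed by `i_n R_{[1,n]}`. For `k < n` the `X_k`-coordinate of this witness is `T_k z_k
    -- - λ z_k - (T_k - λ) z_k = 0`.
    refine ⟨∑ k : Fin n, D.ext m ν L (k + 1) (Pi.single (k : ℕ) (T k (z.1 k)), 0) -
      lam • D.coords m ν L z - D.coords m ν L (W z), ?_, ?_⟩
    · funext i
      rw [trunc]
      split_ifs with hi
      swap
      · rfl
      have hsum : (∑ k : Fin n, D.ext m ν L (k + 1)
          (Pi.single (k : ℕ) (T k (z.1 k)), 0)).1 i = T ⟨i, hi⟩ (z.1 i) := by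
        rw [Prod.fst_sum, Finset.sum_apply, Finset.sum_eq_single ⟨i, hi⟩]
        · simp [ext, trunc]
        · intro k _ hk
          have : i ≠ k := fun h => hk (Fin.ext h.symm)
          simp [ext, trunc, this]
        · simp
      simp only [Prod.fst_sub, Pi.sub_apply, hsum, hW]
      simp [T', hi, coords]
    · have e : ∀ v, D.ext m ν L n v = extL hmν hL hL1 hD n v := fun _ => rfl
      have e1 : ∀ k : Fin n, extL hmν hL hL1 hD n (D.ext m ν L (k + 1)
          (Pi.single (k : ℕ) (T k (z.1 k)), 0)) =
          D.ext m ν L (k + 1) (Pi.single (k : ℕ) (T k (z.1 k)), 0) := fun k =>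
        ext_ext hmν hL hL1 hD (Nat.succ_le_of_lt k.2) _
      have hU : D.coords m ν L (UZ z) =
          lam • D.coords m ν L z + D.ext m ν L n (D.coords m ν L (W z)) := by
        rw [← hJ]
        exact coords_smul_add lam z (J n (W z))
      rw [← coordsL_apply, map_sub, coordsL_apply, coordsL_apply, hScoords, hU, e, e, map_sub,
        map_sub, map_sum, map_smul, diag, e]
      simp only [e1]
      rw [smul_sub]
      have : ∀ a b c d : D.Vec, a + (b - c) - (b + d) = a - c - d := fun a b c d => by abel
      exact this _ _ _ _
  have hfin : FiniteDimensional ℝ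
      (LinearMap.range ((S - U : D.space m ν L →L[ℝ] D.space m ν L) :
        D.space m ν L →ₗ[ℝ] D.space m ν L)) := by
    have := (finite_gam (D := D) (m := m) (ν := ν) (L := L) n).to_subtype
    -- A value `i_n(0, c)` is determined by its restriction `c` to `Γ_n`, so restriction is
    -- injective on the range.
    refine LinearMap.finiteDimensional_range_of_comp _
      ((LinearMap.funLeft ℝ ℝ (Subtype.val : D.Gam m ν L n → ℕ)).comp
        ((LinearMap.snd ℝ _ _).comp ((coordsL D m ν L).comp (D.space m ν L).subtype)))
      fun z h0 => ?_
    obtain ⟨w, hw1, hw⟩ := hK z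
    have hSU : (((S - U) z : D.space m ν L) : D.ZInfty m ν L) = SZ z - UZ z := by
      rw [← hS, ← hU]
      rfl
    have h2 : ∀ γ ∈ D.Gam m ν L n, w.2 γ = 0 := fun γ hγ => by
      have h : (D.coords m ν L ((S - U) z : D.space m ν L)).2 γ = 0 := congrFun h0 ⟨γ, hγ⟩
      rwa [hSU, hw, ext_of_mem_gam _ hγ] at h
    refine Subtype.ext (coords_injective ?_)
    refine (congrArg _ hSU).trans (hw.trans ?_)
    rw [ext_congr (w := 0) (hw1.trans (by funext k; simp [trunc])) h2,
      ext_zero hmν hL hL1 hD n]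
    exact (map_zero (coordsL D m ν L)).symm
  refine ⟨S, fun z => by rw [hS, hScoords], S - U,
    ContinuousLinearMap.isCompactOperator_of_finiteDimensional_range _, hfin, ?_⟩
  refine ContinuousLinearMap.opNorm_le_bound _ (by
    have : 0 < (m (sInf L) : ℝ) - 2 := by linarith
    positivity) fun z => ?_
  have hz : (S - (S - U)) z = U z := sub_sub_cancel (S z) (U z)
  rw [hz]
  exact (congrArg norm (hU z)).trans_le (hUnorm z)
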